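/- For a nonzero polynomial $p$ in $\mathbb{C}[x_1,\dots,x_l]$ with factorization $p = c\,p_1^{e_1}\cdots p_s^{e_s}$, where $c\in\mathbb{C}^*$, the $p_i$ are irreducible and pairwise non-associate, and all $e_i\ge 1$, let $r(p) := \deg(p_1p_2\cdots p_s)$ be the total degree of the square-free part of $p$. **Theorem.** Let $n \ge 3$ and let $f_1, f_2, \ldots, f_n \in \mathbb{C}[x_1,\dots,x_l]$ be (possibly multivariate) polynomials, not all constant, such that $$f_1 + f_2 + \cdots + f_n = 0.$$ Assume furthermore that for every $s \ge 1$ and all $1 \le i_1 < i_2 < \cdots < i_s \le n$, $$f_{i_1} + f_{i_2} + \cdots + f_{i_s} = 0 \ \Longrightarrow\ \gcd\{f_{i_1}, f_{i_2}, \ldots, f_{i_s}\} = 1.$$ (In particular, taking $s=1$ and using $\gcd\{0\}=0$, no $f_i$ is zero.) Then $$\max_{1 \le m \le n} \deg f_m \le (n-2)\Big(r(f_1) + r(f_2) + \cdots + r(f_n) - 1\Big),$$ where $\deg$ denotes the total degree. -/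

import Mathlib

/-- The square-free part of a polynomial `p` over `ℂ`: the product of the irreducible factors of
`p`, one from each class of associates, each taken once. It is determined up to a nonzero constant
factor; here the representatives of the classes are chosen by an arbitrary normalization. -/
noncomputable def squarefreePart {l : ℕ} (p : MvPolynomial (Fin l) ℂ) :
    MvPolynomial (Fin l) ℂ :=
  letI : StrongNormalizationMonoid (MvPolynomial (Fin l) ℂ) :=
    UniqueFactorizationMonoid.strongNormalizationMonoid
  UniqueFactorizationMonoid.radical p

/-- `r(p)`, the (total) degree of the square-free part of `p`. -/
noncomputable def radicalDegree {l : ℕ} (p : MvPolynomial (Fin l) ℂ) : ℕ :=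
  (squarefreePart p).totalDegree

/-- `d` is a greatest common divisor of the polynomials `f i`, `i ∈ S`: a common divisor which is
divisible by every common divisor. -/
def IsGCDOn {l n : ℕ} (f : Fin n → MvPolynomial (Fin l) ℂ) (S : Finset (Fin n))
    (d : MvPolynomial (Fin l) ℂ) : Prop :=
  (∀ i ∈ S, d ∣ f i) ∧ ∀ e : MvPolynomial (Fin l) ℂ, (∀ i ∈ S, e ∣ f i) → e ∣ d

/-! After a linear change of variables, single out one variable: the `f i` become univariate over
the algebraic closure of a rational function field, the degree of the chosen `f m` is preserved, and
`r (f i)` bounds the number of distinct roots. By Gauss's lemma, subfamilies with sum zero still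
have no common root.

For univariate `f i`, bound the degree of the gcd of `f i`, `i ∈ D`, starting from `D = {m}`. If the
sum over `D` is nonzero, it is a combination with nonzero coefficients of independent members
indexed by some `E` disjoint from `D`. The Wronskian of `E` is, up to nonzero constants, unchanged
when one member is traded for that sum. Comparing its degree with its orders at the roots shows that
passing to `D ∪ E` lowers the gcd degree by at most `(|E| - 1)(R - 1)`, where `R` totals the
distinct roots (`gcdDegreeOn_step`). Once the sum over `D` vanishes, the gcd is trivial. The sets
`E` are disjoint and avoid `m`, so the numbers `|E| - 1` add up to at most `n - 2`. -/

open Polynomial in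
/-- The matrix of iterated derivatives whose determinant is the Wronskian of a family of
polynomials. -/
noncomputable def derivativeMatrix {R : Type*} [CommRing R] {k : ℕ} (g : Fin k → R[X]) :
    Matrix (Fin k) (Fin k) R[X] :=
  Matrix.of fun i j => derivative^[j] (g i)

open Polynomial in
/-- The Wronskian of a finite family of polynomials. -/
noncomputable def multiWronskian {R : Type*} [CommRing R] {k : ℕ} (g : Fin k → R[X]) : R[X] :=
  (derivativeMatrix g).det

/-! ### Wronskians: degree bound and nonvanishing in characteristic zero. -/

section Wronskian

open Polynomial

variable {K : Type*} [Field K]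

theorem natDegree_X_pow_mul_iterate_derivative_le (p : K[X]) (j : ℕ) :
    (X ^ j * derivative^[j] p).natDegree ≤ p.natDegree := by
  by_cases hj : p.natDegree < j
  · simp [iterate_derivative_eq_zero hj]
  · have h1 := natDegree_mul_le (p := (X : K[X]) ^ j) (q := derivative^[j] p)
    have h2 := natDegree_iterate_derivative p j
    rw [natDegree_X_pow] at h1
    omega

theorem coeff_natDegree_X_pow_mul_iterate_derivative (p : K[X]) (j : ℕ) :
    (X ^ j * derivative^[j] p).coeff p.natDegree =
      p.leadingCoeff * (p.natDegree.descFactorial j : K) := by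
  rw [coeff_X_pow_mul']
  split_ifs with h
  · rw [coeff_iterate_derivative, Nat.sub_add_cancel h, nsmul_eq_mul, mul_comm, leadingCoeff]
  · rw [Nat.descFactorial_eq_zero_iff_lt.2 (not_le.1 h)]
    simp

theorem coeff_prod_sum_of_natDegree_le {ι : Type*} (s : Finset ι) (f : ι → K[X]) (d : ι → ℕ)
    (h : ∀ i ∈ s, (f i).natDegree ≤ d i) :
    (∏ i ∈ s, f i).coeff (∑ i ∈ s, d i) = ∏ i ∈ s, (f i).coeff (d i) := by
  classical
  induction s using Finset.induction_on with
  | empty => simp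
  | insert a s ha ih =>
    have hs : ∀ i ∈ s, (f i).natDegree ≤ d i := fun i hi => h i (Finset.mem_insert_of_mem hi)
    rw [Finset.prod_insert ha, Finset.sum_insert ha, Finset.prod_insert ha,
      coeff_mul_add_eq_of_natDegree_le (h a (Finset.mem_insert_self a s)), ih hs]
    exact (natDegree_prod_le s f).trans (Finset.sum_le_sum hs)

theorem natDegree_det_le_sum {k : ℕ} (M : Matrix (Fin k) (Fin k) K[X]) (d : Fin k → ℕ)
    (h : ∀ i j, (M i j).natDegree ≤ d i) : M.det.natDegree ≤ ∑ i, d i := by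
  rw [← Matrix.det_transpose, Matrix.det_apply]
  refine natDegree_sum_le_of_forall_le _ _ fun σ _ => ?_
  refine (natDegree_smul_le _ _).trans ?_
  exact (natDegree_prod_le _ _).trans (Finset.sum_le_sum fun i _ => h i _)

theorem coeff_det_sum {k : ℕ} (M : Matrix (Fin k) (Fin k) K[X]) (d : Fin k → ℕ)
    (h : ∀ i j, (M i j).natDegree ≤ d i) :
    M.det.coeff (∑ i, d i) = (Matrix.of fun i j => (M i j).coeff (d i)).det := by
  rw [← Matrix.det_transpose, Matrix.det_apply, ← Matrix.det_transpose, Matrix.det_apply,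
    finsetSum_coeff]
  refine Finset.sum_congr rfl fun σ _ => ?_
  rw [coeff_smul]
  congr 1
  exact coeff_prod_sum_of_natDegree_le _ _ _ fun i _ => h i _

theorem det_X_pow_mul_iterate_derivative {k : ℕ} (g : Fin k → K[X]) :
    (Matrix.of fun i j : Fin k => X ^ (j : ℕ) * derivative^[j] (g i)).det =
      X ^ (∑ j ∈ Finset.range k, j) * multiWronskian g := by
  rw [multiWronskian, ← Fin.sum_univ_eq_sum_range (fun j => j), ← Finset.prod_pow_eq_pow_sum,
    ← Matrix.det_mul_row]
  rfl

/-- Multiplying column `j` by `X ^ j` keeps every entry of row `i` within the degree of `g i`. This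
saves `0 + 1 + ⋯ + (k - 1)`, of which only the last term is used. -/
theorem natDegree_multiWronskian_add_le {k : ℕ} (g : Fin k → K[X]) (h : multiWronskian g ≠ 0) :
    (multiWronskian g).natDegree + (k - 1) ≤ ∑ i, (g i).natDegree := by
  have h1 := natDegree_det_le_sum
    (Matrix.of fun i j : Fin k => X ^ (j : ℕ) * derivative^[j] (g i)) (fun i => (g i).natDegree)
    fun i j => natDegree_X_pow_mul_iterate_derivative_le _ _
  rw [det_X_pow_mul_iterate_derivative, natDegree_mul (pow_ne_zero _ X_ne_zero) h,
    natDegree_X_pow] at h1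
  have h2 : k - 1 ≤ ∑ j ∈ Finset.range k, j := by
    rcases Nat.eq_zero_or_pos k with rfl | hk
    · simp
    · exact Finset.single_le_sum (f := fun j => j) (fun _ _ => Nat.zero_le _)
        (Finset.mem_range.2 (Nat.sub_one_lt_of_lt hk))
  omega

theorem det_descFactorial_ne_zero [CharZero K] {k : ℕ} (d : Fin k → ℕ)
    (hd : Function.Injective d) :
    (Matrix.of fun i j : Fin k => ((d i).descFactorial j : K)).det ≠ 0 := by
  have h := Matrix.det_eval_matrixOfPolynomials_eq_det_vandermonde (fun i => (d i : K))
    (fun j => descPochhammer K j) (fun j => descPochhammer_natDegree K j)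
    (fun j => monic_descPochhammer K j)
  simp only [descPochhammer_eval_eq_descFactorial] at h
  rw [← h]
  exact Matrix.det_vandermonde_ne_zero_iff.2 fun i j hij => hd (Nat.cast_injective hij)

/-- The top coefficient of the column-scaled determinant is the product of the leading coefficients
times a determinant of falling factorials, which is a Vandermonde determinant in the distinct
degrees. -/
theorem multiWronskian_ne_zero_of_injective_natDegree [CharZero K] {k : ℕ} (g : Fin k → K[X])
    (h0 : ∀ i, g i ≠ 0) (hd : Function.Injective fun i => (g i).natDegree) :
    multiWronskian g ≠ 0 := by
  intro hW
  have h1 := coeff_det_sum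
    (Matrix.of fun i j : Fin k => X ^ (j : ℕ) * derivative^[j] (g i)) (fun i => (g i).natDegree)
    fun i j => natDegree_X_pow_mul_iterate_derivative_le _ _
  rw [det_X_pow_mul_iterate_derivative, hW, mul_zero, coeff_zero] at h1
  simp only [Matrix.of_apply, coeff_natDegree_X_pow_mul_iterate_derivative] at h1
  have h2 := Matrix.det_mul_column (fun i => (g i).leadingCoeff)
    (Matrix.of fun i j : Fin k => ((g i).natDegree.descFactorial j : K))
  simp only [Matrix.of_apply] at h2
  rw [h2] at h1
  refine mul_ne_zero (Finset.prod_ne_zero_iff.2 fun i _ => leadingCoeff_ne_zero.2 (h0 i))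
    (det_descFactorial_ne_zero _ hd) h1.symm

theorem derivativeMatrix_update {k : ℕ} (g : Fin k → K[X]) (i : Fin k) (p : K[X]) :
    derivativeMatrix (Function.update g i p) =
      (derivativeMatrix g).updateRow i fun j => derivative^[j] p := by
  ext a b : 2
  by_cases h : a = i
  · subst h; simp [derivativeMatrix]
  · simp [derivativeMatrix, h]

theorem multiWronskian_update_sum {k : ℕ} (g : Fin k → K[X]) (c : Fin k → K) (i : Fin k) :
    multiWronskian (Function.update g i (∑ j, c j • g j)) = C (c i) * multiWronskian g := by
  rw [multiWronskian, derivativeMatrix_update, multiWronskian, ← smul_eq_mul,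
    ← Matrix.det_updateRow_sum (derivativeMatrix g) i fun j => C (c j)]
  congr 2
  ext1 b
  simp [derivativeMatrix, iterate_derivative_sum, smul_eq_C_mul]

theorem multiWronskian_update_sub_smul {k : ℕ} (g : Fin k → K[X]) (c : K) {i j : Fin k}
    (hij : i ≠ j) :
    multiWronskian (Function.update g i (g i - c • g j)) = multiWronskian g := by
  have h := multiWronskian_update_sum g (Pi.single i 1 - Pi.single j c) i
  simpa [sub_smul, Finset.sum_sub_distrib, Pi.single_apply, ite_smul, hij] using h

theorem linearIndependent_update_sub_smul {k : ℕ} {V : Type*} [AddCommGroup V] [Module K V]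
    {g : Fin k → V} (hg : LinearIndependent K g) (c : K) {i j : Fin k} (hij : i ≠ j) :
    LinearIndependent K (Function.update g i (g i - c • g j)) := by
  rw [Fintype.linearIndependent_iff] at hg ⊢
  intro b hb
  have h1 : ∀ a, b a • Function.update g i (g i - c • g j) a =
      b a • g a - if a = i then (b i * c) • g j else 0 := by
    intro a
    by_cases h : a = i
    · subst h; simp [smul_sub, mul_smul]
    · simp [h]
  have h2 : ∑ a, (b a - if a = j then b i * c else 0) • g a = 0 := by
    simp only [h1, Finset.sum_sub_distrib, Finset.sum_ite_eq', Finset.mem_univ, if_true] at hb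
    simpa [sub_smul, Finset.sum_sub_distrib, ite_smul] using hb
  have h3 := hg _ h2
  have hi : b i = 0 := by simpa [hij] using h3 i
  intro a
  simpa [hi] using h3 a

theorem multiWronskian_ne_zero [CharZero K] {k : ℕ} (g : Fin k → K[X])
    (hg : LinearIndependent K g) : multiWronskian g ≠ 0 := by
  induction hN : ∑ i, (g i).natDegree using Nat.strong_induction_on generalizing g with
  | _ N ih =>
  by_cases hd : Function.Injective fun i => (g i).natDegree
  · exact multiWronskian_ne_zero_of_injective_natDegree g (fun i => hg.ne_zero i) hd
  obtain ⟨i, j, hdeg, hij⟩ : ∃ i j, (g i).natDegree = (g j).natDegree ∧ i ≠ j := by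
    simpa [Function.Injective] using hd
  -- Cancelling the leading terms of two members of equal degree preserves the Wronskian and
  -- independence, and lowers the total degree.
  set c : K := (g i).leadingCoeff / (g j).leadingCoeff with hc
  have hj : (g j).leadingCoeff ≠ 0 := leadingCoeff_ne_zero.2 (hg.ne_zero j)
  have hi : (g i).leadingCoeff ≠ 0 := leadingCoeff_ne_zero.2 (hg.ne_zero i)
  have hc0 : c ≠ 0 := div_ne_zero hi hj
  have hli := linearIndependent_update_sub_smul hg c hij
  have hp0 : g i - c • g j ≠ 0 := by simpa using hli.ne_zero i
  have hlt : (g i - c • g j).natDegree < (g i).natDegree := by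
    refine natDegree_lt_natDegree hp0 (degree_sub_lt_left ?_ (hg.ne_zero i) ?_)
    · rw [degree_smul_of_smul_regular _ (IsSMulRegular.of_ne_zero hc0),
        degree_eq_natDegree (hg.ne_zero i), degree_eq_natDegree (hg.ne_zero j), hdeg]
    · rw [leadingCoeff_smul_of_smul_regular _ (IsSMulRegular.of_ne_zero hc0), smul_eq_mul, hc,
        div_mul_cancel₀ _ hj]
  rw [← multiWronskian_update_sub_smul g c hij]
  refine ih _ ?_ _ hli rfl
  rw [← hN]
  refine Finset.sum_lt_sum (fun a _ => ?_) ⟨i, Finset.mem_univ i, by simpa using hlt⟩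
  by_cases h : a = i
  · subst h; simpa using hlt.le
  · simp [h]

end Wronskian

/-! ### Orders of vanishing of the Wronskian. -/

section Multiplicity

open Polynomial

variable {K : Type*} [Field K]

theorem pow_dvd_multiWronskian {k : ℕ} (g : Fin k → K[X]) (a : K) (e : Fin k → ℕ)
    (h : ∀ i, (X - C a) ^ e i ∣ g i) :
    (X - C a) ^ (∑ i, (e i - (k - 1))) ∣ multiWronskian g := by
  rw [multiWronskian, ← Matrix.det_transpose, Matrix.det_apply]
  refine Finset.dvd_sum fun σ _ => ?_
  rw [Units.smul_def, zsmul_eq_mul, ← Finset.prod_pow_eq_pow_sum]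
  refine dvd_mul_of_dvd_right (Finset.prod_dvd_prod_of_dvd _ _ fun i _ => ?_) _
  refine (pow_dvd_pow _ ?_).trans
    (pow_sub_dvd_iterate_derivative_of_pow_dvd (σ i : ℕ) (h i))
  have := (σ i).isLt
  omega

theorem sum_le_rootMultiplicity_multiWronskian {k : ℕ} (g : Fin k → K[X]) (a : K)
    (e : Fin k → ℕ) (h : ∀ i, (X - C a) ^ e i ∣ g i) (hW : multiWronskian g ≠ 0) :
    ∑ i, e i ≤ (multiWronskian g).rootMultiplicity a + (k - 1) * ∑ i, min (e i) 1 := by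
  have h1 := (le_rootMultiplicity_iff hW).2 (pow_dvd_multiWronskian g a e h)
  -- The truncated subtraction loses at most `k - 1`, and nothing where `e i = 0`.
  have h2 : ∑ i, e i ≤ ∑ i, (e i - (k - 1)) + ∑ i, (k - 1) * min (e i) 1 := by
    rw [← Finset.sum_add_distrib]
    refine Finset.sum_le_sum fun i _ => ?_
    rcases Nat.eq_zero_or_pos (e i) with h0 | h0
    · omega
    · rw [min_eq_right (Nat.succ_le_iff.2 h0)]
      omega
  rw [← Finset.mul_sum] at h2
  omega

/-- Local estimate for the Wronskian: a family member may be traded for a combination `∑ cᵢ gᵢ`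
which vanishes to order at least `d`. -/
theorem sum_rootMultiplicity_add_le [CharZero K] {k : ℕ} (g : Fin k → K[X])
    (hg : LinearIndependent K g) (c : Fin k → K) (hc : ∀ i, c i ≠ 0) (a : K) (d e : ℕ)
    (hd : (X - C a) ^ d ∣ ∑ i, c i • g i)
    (he : d ≤ e ∨ ∃ i, (g i).rootMultiplicity a = e) :
    ∑ i, (g i).rootMultiplicity a + d ≤ (multiWronskian g).rootMultiplicity a + e +
      (k - 1) * (∑ i, min ((g i).rootMultiplicity a) 1 + min d 1) := by
  have hW := multiWronskian_ne_zero g hg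
  have h1 := sum_le_rootMultiplicity_multiWronskian g a (fun i => (g i).rootMultiplicity a)
    (fun i => pow_rootMultiplicity_dvd _ _) hW
  rcases he with he | ⟨i, rfl⟩
  · rw [mul_add]
    omega
  -- Trade the member of order exactly `e` for the combination; the Wronskian only gains the nonzero
  -- constant factor `c i`.
  · have hW' : multiWronskian (Function.update g i (∑ j, c j • g j)) ≠ 0 := by
      rw [multiWronskian_update_sum]
      exact mul_ne_zero (C_ne_zero.2 (hc i)) hW
    have h2 := sum_le_rootMultiplicity_multiWronskian _ a
      (Function.update (fun i => (g i).rootMultiplicity a) i d) (fun j => by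
        by_cases hj : j = i
        · subst hj; simpa using hd
        · simpa [hj] using pow_rootMultiplicity_dvd _ _) hW'
    rw [multiWronskian_update_sum, rootMultiplicity_mul (multiWronskian_update_sum g c i ▸ hW'),
      rootMultiplicity_C, zero_add, Finset.sum_update_of_mem (Finset.mem_univ i)] at h2
    have h3 : ∑ j, min (Function.update (fun i => (g i).rootMultiplicity a) i d j) 1 ≤
        ∑ i, min ((g i).rootMultiplicity a) 1 + min d 1 := by
      calc _ ≤ ∑ j, (min ((g j).rootMultiplicity a) 1 + if j = i then min d 1 else 0) := by
            refine Finset.sum_le_sum fun j _ => ?_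
            by_cases hj : j = i
            · subst hj; simp
            · simp [hj]
        _ = _ := by simp [Finset.sum_add_distrib]
    have h4 := Finset.sum_sdiff (f := fun i => (g i).rootMultiplicity a)
      (Finset.subset_univ {i})
    rw [Finset.sum_singleton] at h4
    have h5 := Nat.mul_le_mul_left (k - 1) h3
    omega

end Multiplicity

/-! ### The univariate inequality. -/

section Univariate

open Polynomial

variable {K : Type*} [Field K]

theorem natDegree_eq_sum_rootMultiplicity [IsAlgClosed K] (p : K[X]) (S : Finset K)
    (hS : ∀ a, p.IsRoot a → a ∈ S) :
    p.natDegree = ∑ a ∈ S, p.rootMultiplicity a := by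
  classical
  rw [(IsAlgClosed.splits p).natDegree_eq_card_roots, ← Multiset.toFinset_sum_count_eq]
  simp only [count_roots]
  refine Finset.sum_subset (fun a ha => hS a ?_) fun a _ ha => ?_
  · exact isRoot_of_mem_roots (Multiset.mem_toFinset.1 ha)
  · rw [Multiset.mem_toFinset, ← Multiset.count_pos, count_roots] at ha
    omega

theorem sum_rootMultiplicity_le_natDegree (p : K[X]) (S : Finset K) :
    ∑ a ∈ S, p.rootMultiplicity a ≤ p.natDegree := by
  classical
  refine le_trans ?_ p.card_roots'
  rw [← Multiset.toFinset_sum_count_eq]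
  simp only [← count_roots]
  refine Finset.sum_le_sum_of_ne_zero fun a _ ha => ?_
  exact Multiset.mem_toFinset.2 (Multiset.count_ne_zero.1 ha)

/-- A nonzero combination of a finite family of vectors is a combination, with all coefficients
nonzero, of a linearly independent subfamily. -/
theorem exists_linearIndependent_fin_sum_eq {ι V : Type*} [AddCommGroup V] [Module K V]
    (T : Finset ι) (v : ι → V) (x : V) (hx : x ≠ 0)
    (hxT : x ∈ Submodule.span K (v '' (T : Set ι))) :
    ∃ (k : ℕ) (u : Fin k ↪ ι) (c : Fin k → K), 0 < k ∧ (∀ i, u i ∈ T) ∧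
      LinearIndependent K (v ∘ u) ∧ (∀ i, c i ≠ 0) ∧ ∑ i, c i • v (u i) = x := by
  classical
  obtain ⟨B, hBT, -, hspan, hB⟩ := exists_linearIndepOn_extension
    (linearIndepOn_empty K v) (Set.empty_subset (T : Set ι))
  have hx' : x ∈ Submodule.span K (v '' B) := by
    have := Submodule.span_mono (R := K) hspan
    rw [Submodule.span_span] at this
    exact this hxT
  obtain ⟨l, hl, hlx⟩ := (Finsupp.mem_span_image_iff_linearCombination K).1 hx'
  let E := l.support.equivFin.symm
  refine ⟨l.support.card, E.toEmbedding.trans (Function.Embedding.subtype _), fun i => l (E i),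
    ?_, fun i => hBT (hl (E i).2), ?_, fun i => Finsupp.mem_support_iff.1 (E i).2, ?_⟩
  · rw [Finset.card_pos, Finsupp.support_nonempty_iff]
    rintro rfl
    exact hx (by simpa using hlx.symm)
  · have h1 : LinearIndepOn K v (l.support : Set ι) := hB.mono hl
    exact h1.linearIndependent.comp E E.injective
  · rw [← hlx, Finsupp.linearCombination_apply, Finsupp.sum,
      ← Finset.sum_coe_sort l.support fun i => l i • v i]
    exact Equiv.sum_comp E fun i : l.support => l i • v i

/-- Sum over `S` of the least multiplicity among the `f i`, `i ∈ D`; this is the degree of the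
greatest common divisor of these polynomials when `S` contains all their roots. -/
noncomputable def gcdDegreeOn {ι : Type*} (f : ι → K[X]) (S : Finset K) (D : Finset ι)
    (hD : D.Nonempty) : ℕ :=
  ∑ a ∈ S, D.inf' hD fun i => (f i).rootMultiplicity a

/-- Sum the local Wronskian estimate over `S`: the degrees of the members of `E` cancel against the
degree bound for the Wronskian, whose saving is the term `E.card - 1` on the left. -/
theorem gcdDegreeOn_step [CharZero K] [IsAlgClosed K] {ι : Type*} [Fintype ι] [DecidableEq ι]
    (f : ι → K[X]) (hsum : ∑ i, f i = 0) (S : Finset K)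
    (hS : ∀ i a, (f i).IsRoot a → a ∈ S) (D : Finset ι) (hD : D.Nonempty)
    (hDsum : ∑ i ∈ D, f i ≠ 0) :
    ∃ E : Finset ι, E.Nonempty ∧ Disjoint D E ∧
      gcdDegreeOn f S D hD + (E.card - 1) ≤
        gcdDegreeOn f S (D ∪ E) (hD.mono Finset.subset_union_left) +
          (E.card - 1) * ∑ i, ∑ a ∈ S, min ((f i).rootMultiplicity a) 1 := by
  have hmem : ∑ i ∈ D, f i ∈ Submodule.span K (f '' ((Dᶜ : Finset ι) : Set ι)) := by
    rw [← Finset.sum_add_sum_compl D f, add_eq_zero_iff_eq_neg] at hsum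
    rw [hsum]
    exact neg_mem (sum_mem fun i hi => Submodule.subset_span ⟨i, hi, rfl⟩)
  obtain ⟨k, u, c, hk, huD, hli, hc, hcsum⟩ :=
    exists_linearIndependent_fin_sum_eq Dᶜ f _ hDsum hmem
  obtain ⟨m, hm⟩ := hD
  have hcard : (Finset.univ.map u).card = k := by simp
  have hdisj : Disjoint D (Finset.univ.map u) := by
    rw [Finset.disjoint_left]
    intro i hi hi'
    obtain ⟨j, -, rfl⟩ := Finset.mem_map.1 hi'
    exact Finset.mem_compl.1 (huD j) hi
  refine ⟨Finset.univ.map u, Finset.card_pos.1 (by rwa [hcard]), hdisj, ?_⟩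
  rw [hcard]
  have hD : D.Nonempty := ⟨m, hm⟩
  have hDE := hD.mono (Finset.subset_union_left (s₂ := Finset.univ.map u))
  have hloc : ∀ a ∈ S, ∑ i, ((f ∘ u) i).rootMultiplicity a +
      D.inf' hD (fun i => (f i).rootMultiplicity a) ≤
      (multiWronskian (f ∘ u)).rootMultiplicity a +
      (D ∪ Finset.univ.map u).inf' hDE (fun i => (f i).rootMultiplicity a) +
      (k - 1) * ∑ i, min ((f i).rootMultiplicity a) 1 := by
    intro a _
    refine (sum_rootMultiplicity_add_le (f ∘ u) hli c hc a _
      ((D ∪ Finset.univ.map u).inf' hDE (fun i => (f i).rootMultiplicity a)) ?_ ?_).trans ?_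
    · rw [show ∑ i, c i • (f ∘ u) i = ∑ i ∈ D, f i from hcsum]
      refine Finset.dvd_sum fun i hi => (pow_dvd_pow _ ?_).trans (pow_rootMultiplicity_dvd _ _)
      exact Finset.inf'_le (fun i => (f i).rootMultiplicity a) hi
    · obtain ⟨i, hi, hie⟩ := Finset.exists_mem_eq_inf' hDE (fun i => (f i).rootMultiplicity a)
      rw [hie]
      rcases Finset.mem_union.1 hi with hi | hi
      · exact Or.inl (Finset.inf'_le (fun i => (f i).rootMultiplicity a) hi)
      · obtain ⟨j, -, rfl⟩ := Finset.mem_map.1 hi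
        exact Or.inr ⟨j, rfl⟩
    · gcongr
      -- A common zero on `D` is in particular a zero of `f m`, and `m ∉ E`, so it is charged to an
      -- index not yet counted.
      have h1 : ∑ i ∈ insert m (Finset.univ.map u), min ((f i).rootMultiplicity a) 1 ≤
          ∑ i, min ((f i).rootMultiplicity a) 1 :=
        Finset.sum_le_sum_of_subset (Finset.subset_univ _)
      rw [Finset.sum_insert (Finset.disjoint_left.1 hdisj hm), Finset.sum_map] at h1
      have h2 := Finset.inf'_le (fun i => (f i).rootMultiplicity a) hm
      simp only [Function.comp_apply] at h1 ⊢
      omega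
  have hglob := Finset.sum_le_sum hloc
  simp only [Finset.sum_add_distrib, ← Finset.mul_sum] at hglob
  rw [Finset.sum_comm, Finset.sum_comm (s := S) (t := Finset.univ)] at hglob
  have hdeg : ∑ i, ∑ a ∈ S, ((f ∘ u) i).rootMultiplicity a = ∑ i, ((f ∘ u) i).natDegree :=
    Finset.sum_congr rfl fun i _ =>
      (natDegree_eq_sum_rootMultiplicity _ S (hS _)).symm
  have hW := natDegree_multiWronskian_add_le _ (multiWronskian_ne_zero _ hli)
  have hW' := sum_rootMultiplicity_le_natDegree (multiWronskian (f ∘ u)) S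
  rw [hdeg] at hglob
  unfold gcdDegreeOn
  omega

theorem gcdDegreeOn_le [CharZero K] [IsAlgClosed K] {ι : Type*} [Fintype ι] [DecidableEq ι]
    (f : ι → K[X]) (hsum : ∑ i, f i = 0) (S : Finset K)
    (hS : ∀ i a, (f i).IsRoot a → a ∈ S)
    (hgcd : ∀ D : Finset ι, D.Nonempty → ∑ i ∈ D, f i = 0 → ∀ a, ∃ i ∈ D, ¬ (f i).IsRoot a)
    (D : Finset ι) (hD : D.Nonempty) :
    gcdDegreeOn f S D hD ≤ (Fintype.card ι - 1 - D.card) *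
      (∑ i, ∑ a ∈ S, min ((f i).rootMultiplicity a) 1 - 1) := by
  induction hN : Fintype.card ι - D.card using Nat.strong_induction_on generalizing D with
  | _ N ih =>
  by_cases hDsum : ∑ i ∈ D, f i = 0
  · refine (Finset.sum_eq_zero fun a _ => ?_).trans_le (Nat.zero_le _)
    obtain ⟨i, hi, hia⟩ := hgcd D hD hDsum a
    have := Finset.inf'_le (fun i => (f i).rootMultiplicity a) hi
    rw [rootMultiplicity_eq_zero hia] at this
    exact Nat.le_zero.1 this
  · obtain ⟨E, hE, hdisj, hstep⟩ := gcdDegreeOn_step f hsum S hS D hD hDsum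
    have hcard := Finset.card_union_of_disjoint hdisj
    have hle := Finset.card_le_univ (D ∪ E)
    have hEpos := hE.card_pos
    have h1 := ih _ (by omega) (D ∪ E) (hD.mono Finset.subset_union_left) rfl
    generalize ∑ i, ∑ a ∈ S, min ((f i).rootMultiplicity a) 1 = R at *
    -- The two coefficients add up to at most `card ι - 1 - D.card`, also when `D ∪ E` is everything
    -- and the first one truncates to zero.
    have h2 : gcdDegreeOn f S D hD ≤
        (Fintype.card ι - 1 - (D ∪ E).card) * (R - 1) + (E.card - 1) * (R - 1) := by
      rw [Nat.mul_sub (E.card - 1), mul_one]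
      omega
    refine h2.trans ?_
    rw [← add_mul]
    exact Nat.mul_le_mul_right _ (by omega)

theorem natDegree_le_of_sum_eq_zero [CharZero K] [IsAlgClosed K] {ι : Type*} [Fintype ι]
    (f : ι → K[X]) (hf : ∀ i, f i ≠ 0) (hsum : ∑ i, f i = 0)
    (hgcd : ∀ D : Finset ι, D.Nonempty → ∑ i ∈ D, f i = 0 → ∀ a, ∃ i ∈ D, ¬ (f i).IsRoot a)
    (r : ι → ℕ) (hr : ∀ i, ∀ S : Finset K, (∀ a ∈ S, (f i).IsRoot a) → S.card ≤ r i) (m : ι) :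
    (f m).natDegree ≤ (Fintype.card ι - 2) * (∑ i, r i - 1) := by
  classical
  set S : Finset K := Finset.univ.biUnion fun i => (f i).roots.toFinset with hSdef
  have hS : ∀ i a, (f i).IsRoot a → a ∈ S := fun i a h =>
    Finset.mem_biUnion.2 ⟨i, Finset.mem_univ i, by simpa [hf i] using h⟩
  have h1 := gcdDegreeOn_le f hsum S hS hgcd {m} (Finset.singleton_nonempty m)
  rw [gcdDegreeOn] at h1
  simp only [Finset.inf'_singleton, Finset.card_singleton] at h1
  rw [← natDegree_eq_sum_rootMultiplicity _ S (hS m)] at h1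
  refine h1.trans (Nat.mul_le_mul le_rfl (Nat.sub_le_sub_right (Finset.sum_le_sum fun i _ => ?_) 1))
  refine le_trans ?_
    (hr i (S.filter fun a => (f i).IsRoot a) fun a ha => (Finset.mem_filter.1 ha).2)
  rw [Finset.card_filter]
  refine Finset.sum_le_sum fun a _ => ?_
  split_ifs with h
  · exact min_le_right _ _
  · simp [rootMultiplicity_eq_zero h]

end Univariate

/-! ### From common roots to common factors. -/

section Gauss

open Polynomial

/-- Polynomials over a UFD with a common root outside the base ring have a common irreducible
factor. -/
theorem exists_irreducible_dvd_of_common_root {A F L : Type*} [CommRing A] [IsDomain A]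
    [UniqueFactorizationMonoid A] [Field F] [Algebra A F] [IsFractionRing A F] [Field L]
    [Algebra F L] {ι : Type*} (f : ι → A[X]) (D : Finset ι) (hD : D.Nonempty)
    (hf : ∀ i ∈ D, f i ≠ 0) (a : L)
    (ha : ∀ i ∈ D, (((f i).map (algebraMap A F)).map (algebraMap F L)).IsRoot a) :
    ∃ g : A[X], Irreducible g ∧ ∀ i ∈ D, g ∣ f i := by
  obtain ⟨m, hm⟩ := hD
  let ev : A[X] →+* L :=
    (evalRingHom a).comp ((mapRingHom (algebraMap F L)).comp (mapRingHom (algebraMap A F)))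
  have hev : ∀ i ∈ D, ev (f i) = 0 := ha
  have hinj : Function.Injective (algebraMap A F) := IsFractionRing.injective A F
  have hfac := UniqueFactorizationMonoid.factors_prod (hf m hm)
  obtain ⟨g, hg, hg0⟩ : ∃ g ∈ UniqueFactorizationMonoid.factors (f m), ev g = 0 := by
    have h1 : ev (UniqueFactorizationMonoid.factors (f m)).prod = 0 := by
      obtain ⟨w, hw⟩ := hfac
      have h2 := hev m hm
      rw [← hw, map_mul] at h2
      exact (mul_eq_zero.1 h2).resolve_right (w.isUnit.map ev).ne_zero
    rw [map_multiset_prod] at h1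
    obtain ⟨g, hg, h⟩ := Multiset.mem_map.1 (Multiset.prod_eq_zero_iff.1 h1)
    exact ⟨g, hg, h⟩
  have hirr := UniqueFactorizationMonoid.irreducible_of_factor g hg
  -- A nonzero constant cannot vanish at `a`. Hence `g` is primitive and stays irreducible over `F`,
  -- where a Bézout identity evaluated at `a` excludes coprimality with `f i`.
  have hdeg : g.natDegree ≠ 0 := by
    intro h
    rw [natDegree_eq_zero] at h
    obtain ⟨c, rfl⟩ := h
    have hc : algebraMap F L (algebraMap A F c) = 0 := by simpa [ev] using hg0
    have hc0 : c = 0 := by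
      rw [← map_zero (algebraMap F L)] at hc
      exact (map_eq_zero_iff _ hinj).1 ((algebraMap F L).injective hc)
    exact hirr.ne_zero (by rw [hc0, C_0])
  have hprim := hirr.isPrimitive hdeg
  have hirrF := (hprim.irreducible_iff_irreducible_map_fraction_map (K := F)).1 hirr
  refine ⟨g, hirr, fun i hi => ?_⟩
  refine hprim.dvd_of_fraction_map_dvd_fraction_map (K := F) ?_
  by_contra hnd
  obtain ⟨u, v, huv⟩ := (hirrF.coprime_iff_not_dvd).2 hnd
  have h1 := congrArg (fun p => (p.map (algebraMap F L)).eval a) huv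
  have h2 : ((g.map (algebraMap A F)).map (algebraMap F L)).eval a = 0 := hg0
  have h3 : (((f i).map (algebraMap A F)).map (algebraMap F L)).eval a = 0 := ha i hi
  simp only [Polynomial.map_add, Polynomial.map_mul, eval_add, eval_mul, h2, h3, mul_zero,
    Polynomial.map_one, eval_one, add_zero] at h1
  exact zero_ne_one h1

end Gauss

/-! ### Linear change of variables preserving the degree. -/

section Shear

open MvPolynomial

variable {K : Type*} [Field K] {l : ℕ}

/-- The linear substitution `x₀ ↦ x₀`, `xᵢ₊₁ ↦ xᵢ₊₁ + bᵢ x₀`. -/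
noncomputable def shearHom (b : Fin l → K) :
    MvPolynomial (Fin (l + 1)) K →ₐ[K] MvPolynomial (Fin (l + 1)) K :=
  aeval (Fin.cons (X 0) fun i => X i.succ + C (b i) * X 0)

theorem shearHom_comp_neg (b : Fin l → K) :
    (shearHom b).comp (shearHom (-b)) = AlgHom.id K _ := by
  ext i : 1
  refine Fin.cases ?_ (fun i => ?_) i <;> simp [shearHom, algHom_C]

/-- A linear change of variables followed by singling out the first variable. -/
noncomputable def shearEquiv (b : Fin l → K) :
    MvPolynomial (Fin (l + 1)) K ≃ₐ[K] Polynomial (MvPolynomial (Fin l) K) :=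
  (AlgEquiv.ofAlgHom (shearHom b) (shearHom (-b)) (shearHom_comp_neg b)
    (by simpa using shearHom_comp_neg (-b))).trans (finSuccEquiv K l)

theorem totalDegree_aeval_le {σ τ : Type*} (g : σ → MvPolynomial τ K)
    (hg : ∀ i, (g i).totalDegree ≤ 1) (f : MvPolynomial σ K) :
    (aeval g f).totalDegree ≤ f.totalDegree := by
  rw [aeval_def, eval₂_eq]
  refine (totalDegree_finsetSum _ _).trans (Finset.sup_le fun s hs => ?_)
  refine (totalDegree_mul _ _).trans ?_
  have h1 : (algebraMap K (MvPolynomial τ K) (coeff s f)).totalDegree = 0 := totalDegree_C _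
  rw [h1, zero_add]
  refine (totalDegree_finsetProd _ _).trans (le_trans ?_ (le_totalDegree hs))
  refine Finset.sum_le_sum fun i _ => (totalDegree_pow _ _).trans ?_
  simpa using Nat.mul_le_mul_left (s i) (hg i)

theorem natDegree_shearEquiv_le (b : Fin l → K) (f : MvPolynomial (Fin (l + 1)) K) :
    (shearEquiv b f).natDegree ≤ f.totalDegree := by
  have h : (shearEquiv b f).natDegree = (finSuccEquiv K l (shearHom b f)).natDegree := rfl
  rw [h, natDegree_finSuccEquiv]
  refine (degreeOf_le_totalDegree _ _).trans (totalDegree_aeval_le _ (fun i => ?_) f)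
  refine Fin.cases (by simp) (fun i => ?_) i
  refine (totalDegree_add _ _).trans (max_le (by simp) ?_)
  refine (totalDegree_mul _ _).trans (by simp)

theorem coeff_aeval_C_mul_X {σ : Type*} (v : σ → K) (f : MvPolynomial σ K) (d : ℕ) :
    (aeval (fun i => Polynomial.C (v i) * Polynomial.X) f).coeff d =
      eval v (homogeneousComponent d f) := by
  induction f using MvPolynomial.induction_on' with
  | add p q hp hq => simp [hp, hq]
  | monomial s c =>
    have hs : (monomial s c) ∈ homogeneousSubmodule σ K s.degree :=
      (mem_homogeneousSubmodule _ _).2 (isHomogeneous_monomial c rfl)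
    have h1 : s.prod (fun i e => (Polynomial.C (v i) * Polynomial.X) ^ e) =
        Polynomial.C (s.prod fun i e => v i ^ e) * Polynomial.X ^ s.degree := by
      simp only [Finsupp.prod, mul_pow, Finset.prod_mul_distrib, Finset.prod_pow_eq_pow_sum,
        Finsupp.degree, map_prod, map_pow]
      rfl
    rw [homogeneousComponent_of_mem hs, aeval_monomial, h1, Polynomial.algebraMap_eq,
      ← mul_assoc, ← Polynomial.C_mul, Polynomial.coeff_C_mul_X_pow]
    split_ifs with h
    · rw [eval_monomial]
    · rw [map_zero]

theorem map_shearEquiv (b : Fin l → K) (f : MvPolynomial (Fin (l + 1)) K) :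
    (shearEquiv b f).map (eval (0 : Fin l → K)) =
      aeval (fun i => Polynomial.C ((Fin.cons 1 b : Fin (l + 1) → K) i) * Polynomial.X) f := by
  have h : ((Polynomial.mapAlgHom (aeval (0 : Fin l → K))).comp
      ((finSuccEquiv K l).toAlgHom.comp (shearHom b))) =
      aeval (fun i => Polynomial.C ((Fin.cons 1 b : Fin (l + 1) → K) i) * Polynomial.X) := by
    ext i : 1
    refine Fin.cases ?_ (fun i => ?_) i <;>
      simp [shearHom, finSuccEquiv_apply]
  exact DFunLike.congr_fun h f

theorem eval_smul_of_isHomogeneous {σ : Type*} {d : ℕ} {p : MvPolynomial σ K}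
    (hp : p.IsHomogeneous d) (c : K) (v : σ → K) : eval (c • v) p = c ^ d * eval v p := by
  rw [eval_eq, eval_eq, Finset.mul_sum]
  refine Finset.sum_congr rfl fun s hs => ?_
  simp only [Pi.smul_apply, smul_eq_mul, mul_pow, Finset.prod_mul_distrib,
    Finset.prod_pow_eq_pow_sum]
  rw [← hp.degree_eq_sum_deg_support hs]
  ring

theorem exists_eval_cons_one_ne_zero [Infinite K] {d : ℕ} {p : MvPolynomial (Fin (l + 1)) K}
    (hp : p.IsHomogeneous d) (hp0 : p ≠ 0) :
    ∃ b : Fin l → K, eval (Fin.cons 1 b : Fin (l + 1) → K) p ≠ 0 := by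
  -- The factor `X 0` forces `w 0 ≠ 0`, so that `w` can be rescaled to first coordinate `1`.
  obtain ⟨w, hw⟩ : ∃ w, eval w (p * X 0) ≠ 0 := by
    by_contra! h
    exact mul_ne_zero hp0 (X_ne_zero 0) (MvPolynomial.funext fun w => by rw [h w, map_zero])
  rw [map_mul, eval_X] at hw
  have hw0 := right_ne_zero_of_mul hw
  refine ⟨fun i => (w 0)⁻¹ * w i.succ, ?_⟩
  have h1 : (Fin.cons 1 fun i => (w 0)⁻¹ * w i.succ : Fin (l + 1) → K) = (w 0)⁻¹ • w := by
    ext i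
    refine Fin.cases ?_ (fun i => ?_) i <;> simp [hw0]
  rw [h1, eval_smul_of_isHomogeneous hp]
  exact mul_ne_zero (pow_ne_zero _ (inv_ne_zero hw0)) (left_ne_zero_of_mul hw)

/-- Setting the other variables to zero after the shear, the coefficient in degree `f.totalDegree`
is the top homogeneous component at `(1, b)`; a generic `b` makes it nonzero. -/
theorem exists_totalDegree_le_natDegree_shearEquiv [Infinite K]
    (f : MvPolynomial (Fin (l + 1)) K) (hf : f ≠ 0) :
    ∃ b : Fin l → K, f.totalDegree ≤ (shearEquiv b f).natDegree := by
  have h0 : homogeneousComponent f.totalDegree f ≠ 0 := by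
    obtain ⟨s, hs, hd⟩ := Finset.exists_mem_eq_sup f.support (support_nonempty.2 hf)
      fun s => s.sum fun _ e => e
    replace hd : f.totalDegree = s.degree := hd
    intro h
    have h1 := coeff_homogeneousComponent f.totalDegree f s
    rw [h, if_pos hd.symm, coeff_zero] at h1
    exact mem_support_iff.1 hs h1.symm
  obtain ⟨b, hb⟩ := exists_eval_cons_one_ne_zero (homogeneousComponent_isHomogeneous _ f) h0
  rw [← coeff_aeval_C_mul_X, ← map_shearEquiv] at hb
  exact ⟨b, (Polynomial.le_natDegree_of_ne_zero hb).trans Polynomial.natDegree_map_le⟩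

end Shear

/-! ### Reduction to one variable and conclusion. -/

section Main

theorem dvd_squarefreePart_pow {l : ℕ} (p : MvPolynomial (Fin l) ℂ) (hp : p ≠ 0) :
    ∃ N, p ∣ squarefreePart p ^ N :=
  letI : StrongNormalizationMonoid (MvPolynomial (Fin l) ℂ) :=
    UniqueFactorizationMonoid.strongNormalizationMonoid
  UniqueFactorizationMonoid.exists_dvd_radical_self_pow hp

theorem squarefreePart_ne_zero {l : ℕ} (p : MvPolynomial (Fin l) ℂ) : squarefreePart p ≠ 0 :=
  letI : StrongNormalizationMonoid (MvPolynomial (Fin l) ℂ) :=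
    UniqueFactorizationMonoid.strongNormalizationMonoid
  UniqueFactorizationMonoid.radical_ne_zero

theorem totalDegree_le_of_sum_eq_zero {l n : ℕ} (f : Fin n → MvPolynomial (Fin (l + 1)) ℂ)
    (hsum : ∑ i, f i = 0)
    (hgcd : ∀ S : Finset (Fin n), S.Nonempty → ∑ i ∈ S, f i = 0 → IsGCDOn f S 1) (m : Fin n) :
    (f m).totalDegree ≤ (n - 2) * (∑ i, radicalDegree (f i) - 1) := by
  -- If `f i = 0`, then `0` is a common divisor on `{i}` and would divide `1`.
  have hf : ∀ i, f i ≠ 0 := by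
    intro i hi
    have h := (hgcd {i} (Finset.singleton_nonempty i) (by simpa using hi)).2 0
      (by simp [hi])
    exact one_ne_zero (zero_dvd_iff.1 h)
  obtain ⟨b, hb⟩ := exists_totalDegree_le_natDegree_shearEquiv (f m) (hf m)
  let F := FractionRing (MvPolynomial (Fin l) ℂ)
  let φ : MvPolynomial (Fin (l + 1)) ℂ →+* Polynomial (AlgebraicClosure F) :=
    (Polynomial.mapRingHom (algebraMap F (AlgebraicClosure F))).comp
      ((Polynomial.mapRingHom (algebraMap (MvPolynomial (Fin l) ℂ) F)).comp
        (shearEquiv b : _ →+* _))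
  have hinj : Function.Injective (algebraMap (MvPolynomial (Fin l) ℂ) F) :=
    IsFractionRing.injective _ F
  have hdeg : ∀ p, (φ p).natDegree = (shearEquiv b p).natDegree := fun p =>
    (Polynomial.natDegree_map _).trans (Polynomial.natDegree_map_eq_of_injective hinj _)
  have hφ : Function.Injective φ :=
    (Polynomial.map_injective _ (algebraMap F (AlgebraicClosure F)).injective).comp
      ((Polynomial.map_injective _ hinj).comp (shearEquiv b).injective)
  have : CharZero F := charZero_of_injective_algebraMap hinj
  have : CharZero (AlgebraicClosure F) :=
    charZero_of_injective_algebraMap (algebraMap F (AlgebraicClosure F)).injective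
  have key := natDegree_le_of_sum_eq_zero (fun i => φ (f i))
    (fun i => (map_ne_zero_iff φ hφ).2 (hf i)) (by rw [← map_sum, hsum, map_zero]) ?_
    (fun i => radicalDegree (f i)) ?_ m
  · rw [Fintype.card_fin] at key
    exact (hb.trans (hdeg (f m)).ge).trans key
  · intro D hD hDsum a
    rw [← map_sum, map_eq_zero_iff φ hφ] at hDsum
    by_contra hcon
    push Not at hcon
    obtain ⟨g, hg, hgd⟩ := exists_irreducible_dvd_of_common_root (F := F)
      (fun i => shearEquiv b (f i)) D hD (fun i _ => (map_ne_zero_iff _ (shearEquiv b).injective).2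
        (hf i)) a hcon
    have h1 := (hgcd D hD hDsum).2 ((shearEquiv b).symm g) fun i hi => by
      simpa using map_dvd (shearEquiv b).symm (hgd i hi)
    have h2 := map_dvd (shearEquiv b) h1
    rw [AlgEquiv.apply_symm_apply, map_one] at h2
    exact hg.not_isUnit (isUnit_of_dvd_one h2)
  · intro i S hS
    -- Every root of `φ (f i)` is a root of the image of the square-free part, whose degree is at
    -- most `radicalDegree (f i)`.
    obtain ⟨N, hN⟩ := dvd_squarefreePart_pow (f i) (hf i)
    have hq0 : φ (squarefreePart (f i)) ≠ 0 := (map_ne_zero_iff φ hφ).2 (squarefreePart_ne_zero _)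
    refine le_trans ?_ (((hdeg _).trans_le (natDegree_shearEquiv_le b _)))
    refine Polynomial.card_le_degree_of_subset_roots fun a ha => ?_
    rw [Polynomial.mem_roots hq0]
    have h1 := Polynomial.IsRoot.dvd (hS a ha) (map_dvd φ hN)
    rw [map_pow, Polynomial.IsRoot, Polynomial.eval_pow] at h1
    exact by_contra fun h => pow_ne_zero N h h1

end Main

theorem mainTheorem4 {l n : ℕ} (hn : 3 ≤ n) (f : Fin n → MvPolynomial (Fin l) ℂ)
    (hconst : ¬ ∀ i, ∃ c : ℂ, f i = MvPolynomial.C c)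
    (hsum : ∑ i, f i = 0)
    (hgcd : ∀ S : Finset (Fin n), S.Nonempty → ∑ i ∈ S, f i = 0 → IsGCDOn f S 1) :
    ((Finset.univ.sup fun m => (f m).totalDegree : ℕ) : ℤ) ≤
      ((n : ℤ) - 2) * ((∑ i, (radicalDegree (f i) : ℤ)) - 1) := by
  cases l with
  | zero => exact absurd (fun i => ⟨_, MvPolynomial.eq_C_of_isEmpty (f i)⟩) hconst
  | succ l =>
    have hbound := totalDegree_le_of_sum_eq_zero f hsum hgcd
    -- Needed to turn truncated subtraction into integer subtraction: were the sum zero, the bound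
    -- would make every `f i` constant.
    have hpos : 1 ≤ ∑ i, radicalDegree (f i) := by
      by_contra h
      refine hconst fun i => ⟨_, MvPolynomial.totalDegree_eq_zero_iff_eq_C.1 (Nat.le_zero.1 ?_)⟩
      simpa [Nat.lt_one_iff.1 (not_le.1 h)] using hbound i
    have h := Finset.sup_le (s := Finset.univ) fun m _ => hbound m
    zify [hpos, (by omega : 2 ≤ n)] at h
    simpa using h
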